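/- Let $\mathbb F=\mathbb R$ or $\mathbb F=\mathbb C$, let $-\infty<a<b<\infty$ and $1\le p<\infty$, and let $L_p(a,b)$ be the Banach space of (classes of) $\mathbb F$-valued functions on $(a,b)$, with respect to Lebesgue measure. For $n\in\mathbb N=\{1,2,\dots\}$ let $W_p^n(a,b)$ be the subspace of those $f\in L_p(a,b)$ that have a representative $f(\cdot)\in C^{n-1}[a,b]$ such that $f^{(n-1)}(\cdot)$ is absolutely continuous on $[a,b]$ and its almost everywhere defined derivative $f^{(n)}$ belongs to $L_p(a,b)$. For a (bounded or unbounded) linear operator $A$ in a Banach space $X$ with domain $D(A)$, let $A^0=I$ (the identity operator on $X$) and let $A^{k+1}f=A(A^kf)$ with domain $D(A^{k+1})=\{f\in D(A^k): A^kf\in D(A)\}$. The operator $A$ is called chaotic if (i) it is hypercyclic, i.e., there is a nonzero vector $f\in\bigcap_{k\ge 0}D(A^k)$ whose orbit $\{A^kf: k=0,1,2,\dots\}$ is dense in $X$; and (ii) the set of its periodic points, i.e., of the vectors $f$ such that $f\in D(A^N)$ and $A^Nf=f$ for some $N\in\mathbb N$, is dense in $X$. **Theorem 3.4 (Chaoticity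 of Derivatives in $L_p(a,b)$).** For every $n\in\mathbb N$, the $n$-th derivative $D^nf:=f^{(n)}$ with maximal domain $D(D^n):=W_p^n(a,b)$ is a chaotic operator in $L_p(a,b)$. -/

import Mathlib

open MeasureTheory Set
open scoped ENNReal

namespace LinearChaos

section Abstract

variable {𝕜 : Type*} [RCLike 𝕜] {X : Type*} [NormedAddCommGroup X] [NormedSpace 𝕜 X]

/-- The product `B A` of two (possibly unbounded) linear operators in `X`, with its natural
domain `{x ∈ D(A) | A x ∈ D(B)}`. -/
def opComp (B A : X →ₗ.[𝕜] X) : X →ₗ.[𝕜] X where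
  domain :=
    { carrier := {x | ∃ h : x ∈ A.domain, A ⟨x, h⟩ ∈ B.domain}
      zero_mem' := ⟨A.domain.zero_mem, by
        have h0 : A ⟨0, A.domain.zero_mem⟩ = 0 := A.map_zero
        rw [h0]; exact B.domain.zero_mem⟩
      add_mem' := by
        rintro x y ⟨hx, hx'⟩ ⟨hy, hy'⟩
        refine ⟨A.domain.add_mem hx hy, ?_⟩
        have h : A ⟨x + y, A.domain.add_mem hx hy⟩ = A ⟨x, hx⟩ + A ⟨y, hy⟩ :=
          A.map_add ⟨x, hx⟩ ⟨y, hy⟩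
        rw [h]; exact B.domain.add_mem hx' hy'
      smul_mem' := by
        rintro c x ⟨hx, hx'⟩
        refine ⟨A.domain.smul_mem c hx, ?_⟩
        have h : A ⟨c • x, A.domain.smul_mem c hx⟩ = c • A ⟨x, hx⟩ :=
          A.map_smul c ⟨x, hx⟩
        rw [h]; exact B.domain.smul_mem c hx' }
  toFun :=
    { toFun := fun x => B ⟨A ⟨x.1, x.2.1⟩, x.2.2⟩
      map_add' := fun x y => by
        rw [← B.map_add]
        congr 1
        exact Subtype.ext (A.map_add ⟨x.1, x.2.1⟩ ⟨y.1, y.2.1⟩)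
      map_smul' := fun c x => by
        rw [RingHom.id_apply, ← B.map_smul]
        congr 1
        exact Subtype.ext (A.map_smul c ⟨x.1, x.2.1⟩) }

/-- The powers `A ^ k` of a (possibly unbounded) linear operator in `X`, each with its natural
domain; `A ^ 0` is the identity operator on all of `X`. -/
def opPow (A : X →ₗ.[𝕜] X) : ℕ → (X →ₗ.[𝕜] X)
  | 0 => LinearMap.toPMap LinearMap.id ⊤
  | k + 1 => opComp A (opPow A k)

/-- `f` is a hypercyclic vector of `A`: it is nonzero, lies in the domain of every power of `A`,
and its orbit `{A ^ k f | k = 0, 1, 2, …}` is dense in `X`. -/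
def IsHypercyclicVector (A : X →ₗ.[𝕜] X) (f : X) : Prop :=
  f ≠ 0 ∧ ∃ h : ∀ k : ℕ, f ∈ (opPow A k).domain,
    Dense (Set.range fun k : ℕ => opPow A k ⟨f, h k⟩)

/-- `A` is hypercyclic: it has a hypercyclic vector. -/
def IsHypercyclic (A : X →ₗ.[𝕜] X) : Prop :=
  ∃ f : X, IsHypercyclicVector A f

/-- The set of periodic points of `A`: the vectors `f ∈ D(A ^ N)` with `A ^ N f = f` for some
`N ≥ 1`. -/
def periodicPoints (A : X →ₗ.[𝕜] X) : Set X :=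
  {f | ∃ N : ℕ, 1 ≤ N ∧ ∃ h : f ∈ (opPow A N).domain, opPow A N ⟨f, h⟩ = f}

/-- `A` is chaotic: it is hypercyclic and its set of periodic points is dense in `X`. -/
def IsChaotic (A : X →ₗ.[𝕜] X) : Prop :=
  IsHypercyclic A ∧ Dense (periodicPoints A)

end Abstract

section Derivative

/-- The space `L_p(a,b)` of `𝕜`-valued functions with respect to Lebesgue measure. -/
abbrev LpInterval (𝕜 : Type*) [RCLike 𝕜] (p : ℝ≥0∞) (a b : ℝ) : Type _ :=
  Lp 𝕜 p (volume.restrict (Ioo a b))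

variable {𝕜 : Type*} [RCLike 𝕜]

/-- For `n ≥ 1`: the function `F` is of class `C^{n-1}` on `[a,b]`, its derivative `F^{(n-1)}` is
absolutely continuous on `[a,b]`, and its derivative `F^{(n)}`, which then exists almost everywhere,
is in `L_p(a,b)`. Only the values of `F` on `[a,b]` matter, and the derivatives at the end points are
one-sided. (At the points of the null set where `F^{(n-1)}` is not differentiable,
`iteratedDerivWithin n F` takes the value `0`.) -/
structure IsSobolevFunction (p : ℝ≥0∞) (a b : ℝ) (n : ℕ) (F : ℝ → 𝕜) : Prop where
  contDiffOn : ContDiffOn ℝ ((n - 1 : ℕ) : WithTop ℕ∞) F (Icc a b)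
  absolutelyContinuous :
    AbsolutelyContinuousOnInterval (iteratedDerivWithin (n - 1) F (Icc a b)) a b
  memLp : MemLp (iteratedDerivWithin n F (Icc a b)) p (volume.restrict (Ioo a b))

variable {p : ℝ≥0∞} {a b : ℝ} {n : ℕ} {F G : ℝ → 𝕜}

theorem absolutelyContinuousOnInterval_congr (hab : a < b) (hF : AbsolutelyContinuousOnInterval F a b)
    (h : EqOn F G (Icc a b)) : AbsolutelyContinuousOnInterval G a b := by
  rw [absolutelyContinuousOnInterval_iff] at hF ⊢
  intro ε hε
  obtain ⟨δ, hδ, H⟩ := hF ε hε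
  refine ⟨δ, hδ, fun E hE hlt => ?_⟩
  have h1 := H E hE hlt
  have h2 := hE.1
  rw [uIcc_of_le hab.le] at h2
  rw [Finset.sum_congr rfl (fun i hi => by rw [← h (h2 i hi).1, ← h (h2 i hi).2])]
  exact h1

theorem iteratedDerivWithin_pred_add (hab : a < b) (hF : IsSobolevFunction p a b n F)
    (hG : IsSobolevFunction p a b n G) :
    EqOn (iteratedDerivWithin (n - 1) F (Icc a b) + iteratedDerivWithin (n - 1) G (Icc a b))
      (iteratedDerivWithin (n - 1) (F + G) (Icc a b)) (Icc a b) := fun x hx =>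
  (iteratedDerivWithin_add hx (uniqueDiffOn_Icc hab) (hF.contDiffOn x hx)
    (hG.contDiffOn x hx)).symm

theorem ae_differentiableWithinAt (hab : a < b)
    (hF : AbsolutelyContinuousOnInterval F a b) :
    ∀ᵐ x ∂(volume.restrict (Ioo a b)), DifferentiableWithinAt ℝ F (Icc a b) x := by
  rw [ae_restrict_iff' measurableSet_Ioo]
  filter_upwards [hF.boundedVariationOn.ae_differentiableAt_of_mem_uIcc] with x hx hx'
  rw [uIcc_of_le hab.le] at hx
  exact (hx (Ioo_subset_Icc_self hx')).differentiableWithinAt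

theorem iteratedDerivWithin_add_ae (hab : a < b) (hF : IsSobolevFunction p a b n F)
    (hG : IsSobolevFunction p a b n G) :
    iteratedDerivWithin n (F + G) (Icc a b) =ᵐ[volume.restrict (Ioo a b)]
      iteratedDerivWithin n F (Icc a b) + iteratedDerivWithin n G (Icc a b) := by
  cases n with
  | zero => simp
  | succ m =>
    have hpred := iteratedDerivWithin_pred_add hab hF hG
    have hmem : ∀ᵐ x ∂(volume.restrict (Ioo a b)), x ∈ Ioo a b :=
      ae_restrict_mem measurableSet_Ioo
    filter_upwards [ae_differentiableWithinAt hab hF.absolutelyContinuous,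
      ae_differentiableWithinAt hab hG.absolutelyContinuous, hmem] with x hx hy hm
    have hm' := Ioo_subset_Icc_self hm
    simp only [Nat.add_sub_cancel] at hpred hx hy
    rw [Pi.add_apply, iteratedDerivWithin_succ, iteratedDerivWithin_succ, iteratedDerivWithin_succ,
      ← derivWithin_add hx hy]
    exact derivWithin_congr hpred.symm (hpred hm').symm

theorem IsSobolevFunction.add (hab : a < b) (hF : IsSobolevFunction p a b n F)
    (hG : IsSobolevFunction p a b n G) : IsSobolevFunction p a b n (F + G) where
  contDiffOn := hF.contDiffOn.add hG.contDiffOn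
  absolutelyContinuous := absolutelyContinuousOnInterval_congr hab
    (hF.absolutelyContinuous.add hG.absolutelyContinuous) (iteratedDerivWithin_pred_add hab hF hG)
  memLp := (hF.memLp.add hG.memLp).ae_eq (iteratedDerivWithin_add_ae hab hF hG).symm

theorem iteratedDerivWithin_smul (c : 𝕜) (k : ℕ) :
    iteratedDerivWithin k (c • F) (Icc a b) = c • iteratedDerivWithin k F (Icc a b) := by
  funext x
  exact iteratedDerivWithin_const_smul_field c F

theorem IsSobolevFunction.smul (c : 𝕜) (hF : IsSobolevFunction p a b n F) :
    IsSobolevFunction p a b n (c • F) where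
  contDiffOn := hF.contDiffOn.const_smul c
  absolutelyContinuous := by
    rw [iteratedDerivWithin_smul]
    exact hF.absolutelyContinuous.const_smul c
  memLp := by
    rw [iteratedDerivWithin_smul]
    exact hF.memLp.const_smul c

theorem IsSobolevFunction.zero : IsSobolevFunction p a b n (0 : ℝ → 𝕜) := by
  have h (k : ℕ) : iteratedDerivWithin k (0 : ℝ → 𝕜) (Icc a b) = 0 := by
    simpa using iteratedDerivWithin_smul (F := (0 : ℝ → 𝕜)) (a := a) (b := b) (0 : 𝕜) k
  refine ⟨contDiffOn_const, ?_, ?_⟩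
  · rw [h]
    simp [AbsolutelyContinuousOnInterval, tendsto_const_nhds]
  · rw [h]
    exact MemLp.zero

/-- Two Sobolev functions that agree almost everywhere on `(a,b)` agree on `[a,b]`. -/
theorem IsSobolevFunction.eqOn (hab : a < b) (hF : IsSobolevFunction p a b n F)
    (hG : IsSobolevFunction p a b n G) (h : F =ᵐ[volume.restrict (Ioo a b)] G) :
    EqOn F G (Icc a b) := by
  rw [Measure.restrict_congr_set Ioo_ae_eq_Icc] at h
  exact Measure.eqOn_Icc_of_ae_eq volume hab.ne h hF.contDiffOn.continuousOn
    hG.contDiffOn.continuousOn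

/-- The Sobolev space `W_p^n(a,b)` (`n ≥ 1`), as a subspace of `L_p(a,b)`: the classes having a
representative of class `C^{n-1}` on `[a,b]` with absolutely continuous `(n-1)`-th derivative and
`n`-th derivative in `L_p(a,b)`. -/
def sobolevSpace (𝕜 : Type*) [RCLike 𝕜] (p : ℝ≥0∞) {a b : ℝ} (hab : a < b) (n : ℕ) :
    Submodule 𝕜 (LpInterval 𝕜 p a b) where
  carrier := {f | ∃ F : ℝ → 𝕜, IsSobolevFunction p a b n F ∧ f =ᵐ[volume.restrict (Ioo a b)] F}
  zero_mem' := ⟨0, IsSobolevFunction.zero, Lp.coeFn_zero _ _ _⟩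
  add_mem' := by
    rintro f g ⟨F, hF, hfF⟩ ⟨G, hG, hgG⟩
    exact ⟨F + G, hF.add hab hG, (Lp.coeFn_add f g).trans (hfF.add hgG)⟩
  smul_mem' := by
    rintro c f ⟨F, hF, hfF⟩
    exact ⟨c • F, hF.smul c, (Lp.coeFn_smul c f).trans (hfF.const_smul c)⟩

/-- The regular representative, unique on `[a,b]`, of an element of `W_p^n(a,b)`. -/
noncomputable def sobolevRep (hab : a < b) (f : sobolevSpace 𝕜 p hab n) : ℝ → 𝕜 :=
  f.2.choose

theorem sobolevRep_spec (hab : a < b) (f : sobolevSpace 𝕜 p hab n) :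
    IsSobolevFunction p a b n (sobolevRep hab f) ∧
      (f : LpInterval 𝕜 p a b) =ᵐ[volume.restrict (Ioo a b)] sobolevRep hab f :=
  f.2.choose_spec

theorem sobolevRep_eqOn (hab : a < b) (f : sobolevSpace 𝕜 p hab n) (hF : IsSobolevFunction p a b n F)
    (h : (f : LpInterval 𝕜 p a b) =ᵐ[volume.restrict (Ioo a b)] F) :
    EqOn (sobolevRep hab f) F (Icc a b) :=
  (sobolevRep_spec hab f).1.eqOn hab hF ((sobolevRep_spec hab f).2.symm.trans h)

/-- The class in `L_p(a,b)` of the `n`-th derivative of an element of `W_p^n(a,b)`. -/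
noncomputable def sobolevDeriv (hab : a < b) (f : sobolevSpace 𝕜 p hab n) : LpInterval 𝕜 p a b :=
  (sobolevRep_spec hab f).1.memLp.toLp _

/-- The `n`-th derivative may be computed from any regular representative. -/
theorem sobolevDeriv_ae_eq (hab : a < b) (f : sobolevSpace 𝕜 p hab n)
    (hF : IsSobolevFunction p a b n F)
    (h : (f : LpInterval 𝕜 p a b) =ᵐ[volume.restrict (Ioo a b)] F) :
    sobolevDeriv hab f =ᵐ[volume.restrict (Ioo a b)] iteratedDerivWithin n F (Icc a b) := by
  have hmem : ∀ᵐ x ∂(volume.restrict (Ioo a b)), x ∈ Ioo a b := ae_restrict_mem measurableSet_Ioo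
  refine (MemLp.coeFn_toLp _).trans ?_
  filter_upwards [hmem] with x hx
  exact iteratedDerivWithin_congr (sobolevRep_eqOn hab f hF h) (Ioo_subset_Icc_self hx)

/-- The operator `D^n f = f^{(n)}` (`n ≥ 1`) in `L_p(a,b)` with maximal domain `W_p^n(a,b)`. -/
noncomputable def derivOp (𝕜 : Type*) [RCLike 𝕜] (p : ℝ≥0∞) {a b : ℝ} (hab : a < b) (n : ℕ) :
    LpInterval 𝕜 p a b →ₗ.[𝕜] LpInterval 𝕜 p a b where
  domain := sobolevSpace 𝕜 p hab n
  toFun :=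
    { toFun := sobolevDeriv hab
      map_add' := fun f g => by
        obtain ⟨hF, hfF⟩ := sobolevRep_spec hab f
        obtain ⟨hG, hgG⟩ := sobolevRep_spec hab g
        have h1 := sobolevDeriv_ae_eq hab (f + g) (hF.add hab hG)
          ((Lp.coeFn_add (f : LpInterval 𝕜 p a b) g).trans (hfF.add hgG))
        refine Lp.ext (h1.trans ((iteratedDerivWithin_add_ae hab hF hG).trans ?_))
        exact ((sobolevDeriv_ae_eq hab f hF hfF).add (sobolevDeriv_ae_eq hab g hG hgG)).symm.trans
          (Lp.coeFn_add _ _).symm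
      map_smul' := fun c f => by
        obtain ⟨hF, hfF⟩ := sobolevRep_spec hab f
        have h1 := sobolevDeriv_ae_eq hab (c • f) (hF.smul c)
          ((Lp.coeFn_smul c (f : LpInterval 𝕜 p a b)).trans (hfF.const_smul c))
        rw [iteratedDerivWithin_smul] at h1
        exact Lp.ext (h1.trans (((sobolevDeriv_ae_eq hab f hF hfF).const_smul c).symm.trans
          (Lp.coeFn_smul c _).symm)) }

end Derivative

end LinearChaos

/-!
# Chaoticity of the derivatives in `L_p(a,b)`

To a sequence `c` of at most geometric growth associate the entire function
`egf a c x = ∑ i, c i (x - a) ^ i / i!`. On these functions `D ^ n` is nothing but the shift of `c`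
by `n` places (`opPow_derivOp_egf`), and they lie in the domain of all powers. The factorials make
the tails of the series small: functions whose first `N` coefficients agree are close in `L_p` when
`N` is large, provided that the remaining coefficients are controlled (`exists_forall_dist_lt`).
Finally, the polynomials, which correspond to the finitely supported `c`, are dense in `L_p(a,b)`
(`dense_polynomial`), by the density of the continuous functions and Weierstrass' theorem.

*Periodic points.* Repeating the coefficients of a polynomial with a long period `n * N` gives a fixed
point of `(D ^ n) ^ N` close to the polynomial.

*Hypercyclic vector.* In the spirit of MacLane's theorem for entire functions, list a countable dense
set of polynomials, each infinitely often, and concatenate their coefficient sequences, separated by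
rapidly growing stretches of zeros, into one sequence `c` (`exists_universal_sequence`). The shift by
`n * m k` brings the `k`-th polynomial to the front, and what follows starts so late that its
contribution is negligible. So the orbit of `egf a c` approximates every polynomial in the list.
-/

open Filter Topology
open scoped Nat

namespace LinearChaos

/-! ### Exponential generating functions -/

section Egf

variable {𝕜 : Type*} [RCLike 𝕜]

/-- The function `∑ i, (x - a) ^ i / i! • c i`, whose `i`-th derivative at `a` is `c i`; the `c i` are
called its Taylor coefficients below, without the factor `1 / i!`. It is used only for `c` of
geometric growth, so that the series converges everywhere. -/
noncomputable def egf (a : ℝ) (c : ℕ → 𝕜) (x : ℝ) : 𝕜 :=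
  ∑' i, ((x - a) ^ i / (i ! : ℝ)) • c i

/-- The sequence `c` grows at most geometrically with ratio `2`. Any ratio `> 1` would do: it has to
absorb linear growth. -/
def GeomBounded (c : ℕ → 𝕜) : Prop :=
  ∃ C : ℝ, ∀ i, ‖c i‖ ≤ C * 2 ^ i

theorem GeomBounded.shift {c : ℕ → 𝕜} (hc : GeomBounded c) (k : ℕ) :
    GeomBounded fun i => c (k + i) := by
  obtain ⟨C, hC⟩ := hc
  exact ⟨C * 2 ^ k, fun i => (hC (k + i)).trans_eq (by rw [pow_add, mul_assoc])⟩

theorem exists_norm_le_of_eventually_zero {c : ℕ → 𝕜} {D : ℕ} (h : ∀ i, D ≤ i → c i = 0) :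
    ∃ B : ℝ, 0 ≤ B ∧ ∀ i, ‖c i‖ ≤ B := by
  refine ⟨∑ i ∈ Finset.range D, ‖c i‖, by positivity, fun i => ?_⟩
  rcases lt_or_ge i D with hi | hi
  · exact Finset.single_le_sum (f := fun i => ‖c i‖) (fun _ _ => norm_nonneg _)
      (Finset.mem_range.2 hi)
  · rw [h i hi, norm_zero]
    positivity

theorem GeomBounded.of_norm_le {c : ℕ → 𝕜} {B : ℝ} (h : ∀ i, ‖c i‖ ≤ B) : GeomBounded c := by
  have hB : 0 ≤ B := (norm_nonneg _).trans (h 0)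
  exact ⟨B, fun i => (h i).trans (le_mul_of_one_le_right hB (one_le_pow₀ one_le_two))⟩

theorem GeomBounded.of_eventually_zero {c : ℕ → 𝕜} {D : ℕ} (h : ∀ i, D ≤ i → c i = 0) :
    GeomBounded c := by
  obtain ⟨B, -, hB⟩ := exists_norm_le_of_eventually_zero h
  exact .of_norm_le hB

theorem norm_egf_term_le {c : ℕ → 𝕜} {C a x r : ℝ} {i : ℕ} (hi : ‖c i‖ ≤ C * 2 ^ i)
    (hx : |x - a| ≤ r) :
    ‖((x - a) ^ i / (i ! : ℝ)) • c i‖ ≤ C * ((2 * r) ^ i / (i ! : ℝ)) := by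
  have h0 : 0 ≤ C * 2 ^ i := (norm_nonneg _).trans hi
  rw [norm_smul, norm_div, norm_pow, Real.norm_eq_abs, RCLike.norm_natCast]
  calc |x - a| ^ i / (i ! : ℝ) * ‖c i‖ ≤ r ^ i / (i ! : ℝ) * (C * 2 ^ i) := by
        have : 0 ≤ r := (abs_nonneg _).trans hx
        gcongr
    _ = C * ((2 * r) ^ i / (i ! : ℝ)) := by rw [mul_pow]; ring

theorem summable_egf {c : ℕ → 𝕜} (hc : GeomBounded c) (a x : ℝ) :
    Summable fun i => ((x - a) ^ i / (i ! : ℝ)) • c i := by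
  obtain ⟨C, hC⟩ := hc
  exact .of_norm_bounded ((Real.summable_pow_div_factorial (2 * |x - a|)).mul_left C)
    fun i => norm_egf_term_le (hC i) le_rfl

theorem egf_sub {c d : ℕ → 𝕜} (hc : GeomBounded c) (hd : GeomBounded d) (a x : ℝ) :
    egf a (c - d) x = egf a c x - egf a d x := by
  simp only [egf, Pi.sub_apply, smul_sub]
  exact (summable_egf hc a x).tsum_sub (summable_egf hd a x)

/-- Differentiation shifts the Taylor coefficients. -/
theorem hasDerivAt_egf {c : ℕ → 𝕜} (hc : GeomBounded c) (a x : ℝ) :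
    HasDerivAt (egf a c) (egf a (fun i => c (1 + i)) x) x := by
  obtain ⟨C, hC⟩ := hc.shift 1
  set r : ℝ := |x - a| + 1
  let g' : ℕ → ℝ → 𝕜 := fun i y =>
    i.casesOn 0 fun j => ((y - a) ^ j / (j ! : ℝ)) • c (1 + j)
  let u : ℕ → ℝ := fun i => i.casesOn 0 fun j => C * ((2 * r) ^ j / (j ! : ℝ))
  have hu : Summable u := by
    rw [← summable_nat_add_iff 1]
    exact (Real.summable_pow_div_factorial (2 * r)).mul_left C
  have hx : x ∈ Metric.ball a r := by
    rw [Metric.mem_ball, Real.dist_eq]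
    exact lt_add_one _
  have key := hasDerivAt_tsum_of_isPreconnected (g := fun i y => ((y - a) ^ i / (i ! : ℝ)) • c i)
    (g' := g') hu Metric.isOpen_ball (convex_ball a r).isPreconnected
    (fun i y _ => ?_) (fun i y hy => ?_) hx (summable_egf hc a x) hx
  · refine key.congr_deriv ?_
    have hs : Summable fun i => g' i x := by
      rw [← summable_nat_add_iff 1]
      exact summable_egf (hc.shift 1) a x
    rw [hs.tsum_eq_zero_add]
    exact zero_add _
  · cases i with
    | zero => simpa [g'] using hasDerivAt_const y (c 0)
    | succ j =>
      have h1 : HasDerivAt (fun y : ℝ => (y - a) ^ (j + 1) / ((j + 1)! : ℝ))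
          ((y - a) ^ j / (j ! : ℝ)) y := by
        have h2 := (((hasDerivAt_id y).sub_const a).pow (j + 1)).div_const ((j + 1)! : ℝ)
        refine h2.congr_deriv ?_
        have : (j ! : ℝ) ≠ 0 := by positivity
        have : ((j : ℝ) + 1) ≠ 0 := by positivity
        rw [Nat.factorial_succ]
        push_cast
        simp only [id]
        field_simp
      exact (h1.smul_const (c (j + 1))).congr_deriv
        (congrArg (fun i => ((y - a) ^ j / (j ! : ℝ)) • c i) (add_comm j 1))
  · cases i with
    | zero => simp [g', u]
    | succ j =>
      exact norm_egf_term_le (c := fun i => c (1 + i)) (hC j)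
        (by simpa [Real.dist_eq] using (Metric.mem_ball.1 hy).le)

theorem iteratedDeriv_egf {c : ℕ → 𝕜} (hc : GeomBounded c) (a : ℝ) (k : ℕ) :
    iteratedDeriv k (egf a c) = egf a fun i => c (k + i) := by
  induction k with
  | zero => simp
  | succ k ih =>
    rw [iteratedDeriv_succ, ih]
    funext x
    rw [(hasDerivAt_egf (hc.shift k) a x).deriv]
    simp only [← add_assoc]

theorem contDiff_egf {c : ℕ → 𝕜} (hc : GeomBounded c) (a : ℝ) (k : ℕ) :
    ContDiff ℝ k (egf a c) := by
  refine contDiff_of_differentiable_iteratedDeriv (n := (k : ℕ∞)) fun m _ => ?_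
  rw [iteratedDeriv_egf hc]
  exact fun x => (hasDerivAt_egf (hc.shift m) a x).differentiableAt

theorem iteratedDerivWithin_egf {c : ℕ → 𝕜} (hc : GeomBounded c) {a b : ℝ} (hab : a < b) (k : ℕ) :
    EqOn (iteratedDerivWithin k (egf a c) (Icc a b)) (egf a fun i => c (k + i)) (Icc a b) := by
  intro x hx
  rw [iteratedDerivWithin_eq_iteratedDeriv (uniqueDiffOn_Icc hab)
    (contDiff_egf hc a k).contDiffAt hx, iteratedDeriv_egf hc]

/-- If the first `N` coefficients vanish, the function is controlled on `[a, b]` by a tail of an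
exponential series. -/
theorem norm_egf_le {c : ℕ → 𝕜} {C : ℝ} {N : ℕ} (h0 : ∀ i < N, c i = 0)
    (hC : ∀ i, ‖c i‖ ≤ C * 2 ^ i) {a b x : ℝ} (hx : x ∈ Icc a b) :
    ‖egf a c x‖ ≤ C * ∑' i, (2 * (b - a)) ^ (i + N) / ((i + N)! : ℝ) := by
  have hxr : |x - a| ≤ b - a := by
    rw [abs_of_nonneg (sub_nonneg.2 hx.1)]
    exact sub_le_sub_right hx.2 a
  have hs := Real.summable_pow_div_factorial (2 * (b - a))
  have h1 : egf a c x = ∑' i, ((x - a) ^ (i + N) / ((i + N)! : ℝ)) • c (i + N) := by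
    rw [egf, ← (summable_egf ⟨C, hC⟩ a x).sum_add_tsum_nat_add N, Finset.sum_eq_zero, zero_add]
    intro i hi
    rw [h0 i (Finset.mem_range.1 hi), smul_zero]
  rw [h1, ← tsum_mul_left]
  exact tsum_of_norm_bounded (((summable_nat_add_iff N).2 hs).mul_left C).hasSum
    fun i => norm_egf_term_le (hC (i + N)) hxr

/-- Weierstrass' theorem in terms of Taylor coefficients: finitely supported sequences suffice. -/
theorem exists_egf_near (a b : ℝ) {g : ℝ → 𝕜} (hg : Continuous g) {ε : ℝ} (hε : 0 < ε) :
    ∃ (c : ℕ → 𝕜) (D : ℕ), (∀ i, D ≤ i → c i = 0) ∧ ∀ x ∈ Icc a b, ‖g x - egf a c x‖ ≤ ε := by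
  obtain ⟨P, hP⟩ := exists_polynomial_near_of_continuousOn 0 (b - a)
    (fun x => RCLike.re (g (x + a))) (by fun_prop) (ε / 2) (half_pos hε)
  obtain ⟨Q, hQ⟩ := exists_polynomial_near_of_continuousOn 0 (b - a)
    (fun x => RCLike.im (g (x + a))) (by fun_prop) (ε / 2) (half_pos hε)
  set D := max P.natDegree Q.natDegree + 1
  have hPD : P.natDegree < D := Nat.lt_succ_of_le (le_max_left _ _)
  have hQD : Q.natDegree < D := Nat.lt_succ_of_le (le_max_right _ _)
  let c : ℕ → 𝕜 := fun i => (i ! : ℝ) • ((P.coeff i : 𝕜) + (Q.coeff i : 𝕜) * RCLike.I)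
  have hc : ∀ i, D ≤ i → c i = 0 := fun i hi => by
    simp [c, P.coeff_eq_zero_of_natDegree_lt (hPD.trans_le hi),
      Q.coeff_eq_zero_of_natDegree_lt (hQD.trans_le hi)]
  refine ⟨c, D, hc, fun x hx => ?_⟩
  have hval : egf a c x = ((P.eval (x - a) : ℝ) : 𝕜) + ((Q.eval (x - a) : ℝ) : 𝕜) * RCLike.I := by
    rw [egf, tsum_eq_sum (s := Finset.range D), Polynomial.eval_eq_sum_range' hPD,
      Polynomial.eval_eq_sum_range' hQD]
    · push_cast
      rw [Finset.sum_mul, ← Finset.sum_add_distrib]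
      refine Finset.sum_congr rfl fun i _ => ?_
      have : (i ! : ℝ) ≠ 0 := by positivity
      simp only [c]
      rw [smul_smul, div_mul_cancel₀ _ this, RCLike.real_smul_eq_coe_mul]
      push_cast
      ring
    · intro i hi
      rw [hc i (by simpa using hi), smul_zero]
  have hx' : x - a ∈ Icc 0 (b - a) := ⟨sub_nonneg.2 hx.1, sub_le_sub_right hx.2 a⟩
  have h1 := hP _ hx'
  have h2 := hQ _ hx'
  rw [sub_add_cancel, abs_sub_comm] at h1 h2
  have h3 : g x - egf a c x = ((RCLike.re (g x) - P.eval (x - a) : ℝ) : 𝕜) +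
      ((RCLike.im (g x) - Q.eval (x - a) : ℝ) : 𝕜) * RCLike.I := by
    conv_lhs => rw [hval, ← RCLike.re_add_im (g x)]
    push_cast
    ring
  rw [h3]
  refine (norm_add_le _ _).trans ?_
  rw [norm_mul, RCLike.norm_ofReal, RCLike.norm_ofReal]
  have hI : ‖(RCLike.I : 𝕜)‖ ≤ 1 := by
    rw [RCLike.norm_I]
    split_ifs <;> norm_num
  have h4 : |RCLike.im (g x) - Q.eval (x - a)| * ‖(RCLike.I : 𝕜)‖ ≤
      |RCLike.im (g x) - Q.eval (x - a)| :=
    mul_le_of_le_one_right (abs_nonneg _) hI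
  linarith

end Egf

/-! ### Universal and periodic coefficient sequences -/

section Sequences

variable {𝕜 : Type*} [RCLike 𝕜]

/-- A sequence of linear growth whose shift by `n * m k` agrees with the finitely supported sequence
`q k` on a block of length `d k` that contains the support of `q k`. The block is at least as long as
the shift, so that the entries of the shifted sequence beyond it satisfy a linear bound that does not
depend on `k`. -/
theorem exists_universal_sequence {n : ℕ} (hn : 1 ≤ n) (q : ℕ → ℕ → 𝕜)
    (hq : ∀ k, ∃ D, ∀ i, D ≤ i → q k i = 0) :
    ∃ (c : ℕ → 𝕜) (C : ℝ) (m d : ℕ → ℕ), 0 ≤ C ∧ (∀ j, ‖c j‖ ≤ C * (j + 1)) ∧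
      (∀ k, n * m k ≤ d k) ∧ (∀ k, k ≤ d k) ∧ (∀ k, ∀ i < d k, c (n * m k + i) = q k i) ∧
      ∀ k i, d k ≤ i → q k i = 0 := by
  choose D hD using hq
  have hB : ∀ k, ∃ B : ℕ, ∀ i, ‖q k i‖ ≤ B := fun k => by
    obtain ⟨B, -, hB⟩ := exists_norm_le_of_eventually_zero (hD k)
    obtain ⟨N, hN⟩ := exists_nat_ge B
    exact ⟨N, fun i => (hB i).trans hN⟩
  choose B hB using hB
  let m : ℕ → ℕ := fun k => k.rec 0 fun k r => 2 * r + D k + B (k + 1) + k + 1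
  have hm : ∀ k, m (k + 1) = 2 * m k + D k + B (k + 1) + k + 1 := fun k => rfl
  have hmono : StrictMono m := strictMono_nat_of_lt_succ fun k => by rw [hm]; omega
  have hnm : ∀ k, m k ≤ n * m k := fun k => Nat.le_mul_of_pos_left _ hn
  have hBm : ∀ k, B k ≤ B 0 + m k := fun k => by
    cases k with
    | zero => omega
    | succ k => rw [hm]; omega
  have hgap : ∀ k, n * m (k + 1) = n * m k + n * (m k + D k + B (k + 1) + k + 1) := fun k => by
    rw [hm]; ring
  have hd : ∀ k, n * m k + D k + k ≤ n * (m k + D k + B (k + 1) + k + 1) := fun k => by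
    have : D k + B (k + 1) + k + 1 ≤ n * (D k + B (k + 1) + k + 1) :=
      Nat.le_mul_of_pos_left _ hn
    calc n * m k + D k + k ≤ n * m k + n * (D k + B (k + 1) + k + 1) := by omega
      _ = _ := by ring
  -- the index of the block that contains position `j`
  let κ : ℕ → ℕ := fun j => Nat.findGreatest (fun k => n * m k ≤ j) j
  have hκ : ∀ j, n * m (κ j) ≤ j := fun j =>
    Nat.findGreatest_spec (P := fun k => n * m k ≤ j) (m := 0) (Nat.zero_le _)
      (by simp [m])
  have hκ_eq : ∀ k i, n * m k + i < n * m (k + 1) → κ (n * m k + i) = k := fun k i hi => by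
    have h1 : k ≤ κ (n * m k + i) := by
      have := hmono.le_apply (x := k)
      have := hnm k
      exact Nat.le_findGreatest (by omega) (by omega)
    have h2 : m (κ (n * m k + i)) < m (k + 1) :=
      lt_of_mul_lt_mul_left ((hκ _).trans_lt hi) (Nat.zero_le n)
    have h3 : κ (n * m k + i) < k + 1 := hmono.lt_iff_lt.1 h2
    omega
  refine ⟨fun j => q (κ j) (j - n * m (κ j)), B 0 + 1, m,
    fun k => n * (m k + D k + B (k + 1) + k + 1), by positivity, fun j => ?_, fun k => ?_,
    fun k => ?_, fun k i hi => ?_, fun k i hi => ?_⟩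
  · have h1 : B (κ j) ≤ B 0 + j := by
      have := hBm (κ j)
      have := hnm (κ j)
      have := hκ j
      omega
    have h2 : (B (κ j) : ℝ) ≤ B 0 + j := by exact_mod_cast h1
    refine (hB _ _).trans (h2.trans ?_)
    have : (0 : ℝ) ≤ B 0 * j := by positivity
    linarith
  · refine le_trans ?_ (hd k)
    omega
  · refine le_trans ?_ (hd k)
    omega
  · simp only
    rw [hκ_eq k i (by rw [hgap]; exact Nat.add_lt_add_left hi _), Nat.add_sub_cancel_left]
  · have := (hd k).trans hi
    exact hD k i (by omega)

end Sequences

/-! ### The derivative operator on exponential generating functions -/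

section Operator

variable {𝕜 : Type*} [RCLike 𝕜] {p : ℝ≥0∞} {a b : ℝ} {n : ℕ}

theorem isSobolevFunction_egf (hab : a < b) {c : ℕ → 𝕜} (hc : GeomBounded c) (p : ℝ≥0∞) (n : ℕ) :
    IsSobolevFunction p a b n (egf a c) where
  contDiffOn := (contDiff_egf hc a (n - 1)).contDiffOn
  absolutelyContinuous := by
    refine absolutelyContinuousOnInterval_congr hab ?_ (iteratedDerivWithin_egf hc hab (n - 1)).symm
    exact ((contDiff_egf (hc.shift _) a 1).contDiffOn).absolutelyContinuousOnInterval
  memLp := by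
    obtain ⟨C, hC⟩ := hc.shift n
    have hcont : Continuous (egf a fun i => c (n + i)) := (contDiff_egf (hc.shift n) a 0).continuous
    have hmem : ∀ᵐ x ∂(volume.restrict (Ioo a b)), x ∈ Ioo a b := ae_restrict_mem measurableSet_Ioo
    refine MemLp.ae_eq (f := egf a fun i => c (n + i)) ?_ ?_
    · filter_upwards [hmem] with x hx
      exact (iteratedDerivWithin_egf hc hab n (Ioo_subset_Icc_self hx)).symm
    · refine MemLp.of_bound hcont.aestronglyMeasurable
        (C * ∑' i, (2 * (b - a)) ^ (i + 0) / ((i + 0)! : ℝ)) ?_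
      filter_upwards [hmem] with x hx
      exact norm_egf_le (by simp) hC (Ioo_subset_Icc_self hx)

theorem memLp_egf (hab : a < b) {c : ℕ → 𝕜} (hc : GeomBounded c) (p : ℝ≥0∞) :
    MemLp (egf a c) p (volume.restrict (Ioo a b)) := by
  simpa using (isSobolevFunction_egf hab hc p 0).memLp

theorem derivOp_egf (hab : a < b) {c : ℕ → 𝕜} (hc : GeomBounded c) {f : LpInterval 𝕜 p a b}
    (hf : f =ᵐ[volume.restrict (Ioo a b)] egf a c) (n : ℕ) :
    ∃ h : f ∈ (derivOp 𝕜 p hab n).domain,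
      derivOp 𝕜 p hab n ⟨f, h⟩ =ᵐ[volume.restrict (Ioo a b)] egf a fun i => c (n + i) := by
  have hS := isSobolevFunction_egf hab hc p n
  refine ⟨⟨egf a c, hS, hf⟩, (sobolevDeriv_ae_eq hab ⟨f, egf a c, hS, hf⟩ hS hf).trans ?_⟩
  filter_upwards [ae_restrict_mem measurableSet_Ioo] with x hx
  exact iteratedDerivWithin_egf hc hab n (Ioo_subset_Icc_self hx)

variable [Fact (1 ≤ p)]

/-- The `k`-th power of `D ^ n` shifts the Taylor coefficients by `n * k`. -/
theorem opPow_derivOp_egf (hab : a < b) {c : ℕ → 𝕜} (hc : GeomBounded c) {f : LpInterval 𝕜 p a b}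
    (hf : f =ᵐ[volume.restrict (Ioo a b)] egf a c) (n k : ℕ) :
    ∃ h : f ∈ (opPow (derivOp 𝕜 p hab n) k).domain,
      opPow (derivOp 𝕜 p hab n) k ⟨f, h⟩ =ᵐ[volume.restrict (Ioo a b)]
        egf a fun i => c (n * k + i) := by
  induction k with
  | zero => exact ⟨Submodule.mem_top, by simp only [mul_zero, zero_add]; exact hf⟩
  | succ k ih =>
    obtain ⟨h, hk⟩ := ih
    obtain ⟨h', hk'⟩ := derivOp_egf hab (hc.shift (n * k)) hk n
    refine ⟨⟨h, h'⟩, ?_⟩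
    have : (fun i => c (n * (k + 1) + i)) = fun i => c (n * k + (n + i)) := by
      funext i
      rw [mul_add, mul_one, add_assoc]
    rw [this]
    exact hk'

/-- Elements of `L_p` whose first `N` Taylor coefficients agree, with the others at geometrically
bounded distance, are close for large `N`, uniformly in the coefficients. -/
theorem exists_forall_dist_lt (hab : a < b) (p : ℝ≥0∞) [Fact (1 ≤ p)] {C : ℝ} (hC : 0 ≤ C) {ε : ℝ}
    (hε : 0 < ε) : ∃ N₀, ∀ N ≥ N₀, ∀ {c d : ℕ → 𝕜} {f g : LpInterval 𝕜 p a b},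
      GeomBounded c → GeomBounded d → f =ᵐ[volume.restrict (Ioo a b)] egf a c →
      g =ᵐ[volume.restrict (Ioo a b)] egf a d → (∀ i < N, c i = d i) →
      (∀ i ≥ N, ‖c i - d i‖ ≤ C * 2 ^ i) → dist f g < ε := by
  set V : ℝ := (measureUnivNNReal (volume.restrict (Ioo a b)) : ℝ) ^ p.toReal⁻¹
  have ht : Tendsto (fun N => V * (C * ∑' i, (2 * (b - a)) ^ (i + N) / ((i + N)! : ℝ)))
      atTop (𝓝 0) := by
    simpa using ((tendsto_sum_nat_add fun i => (2 * (b - a)) ^ i / (i ! : ℝ)).const_mul C).const_mul V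
  obtain ⟨N₀, hN₀⟩ := eventually_atTop.1 (ht.eventually (gt_mem_nhds hε))
  refine ⟨N₀, fun N hN c d f g hc hd hf hg heq hle => ?_⟩
  have h0 : ∀ i < N, (c - d) i = 0 := fun i hi => sub_eq_zero.2 (heq i hi)
  have h1 : ∀ i, ‖(c - d) i‖ ≤ C * 2 ^ i := fun i => by
    rcases lt_or_ge i N with hi | hi
    · rw [h0 i hi, norm_zero]
      positivity
    · exact hle i hi
  have h2 : ∀ᵐ x ∂(volume.restrict (Ioo a b)), ‖(f - g : LpInterval 𝕜 p a b) x‖ ≤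
      C * ∑' i, (2 * (b - a)) ^ (i + N) / ((i + N)! : ℝ) := by
    filter_upwards [hf, hg, Lp.coeFn_sub f g, ae_restrict_mem measurableSet_Ioo]
      with x hfx hgx hx hm
    rw [hx, Pi.sub_apply, hfx, hgx, ← egf_sub hc hd]
    exact norm_egf_le h0 h1 (Ioo_subset_Icc_self hm)
  have hr : 0 ≤ 2 * (b - a) := by linarith
  rw [dist_eq_norm]
  exact (Lp.norm_le_of_ae_bound (by positivity) h2).trans_lt (hN₀ N hN)

/-- Polynomials are dense in `L_p(a,b)`. -/
theorem dense_polynomial (hab : a < b) (hp : p ≠ ∞) :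
    Dense {f : LpInterval 𝕜 p a b | ∃ (c : ℕ → 𝕜) (D : ℕ), (∀ i, D ≤ i → c i = 0) ∧
      f =ᵐ[volume.restrict (Ioo a b)] egf a c} := by
  refine Metric.dense_iff.2 fun f ε hε => ?_
  obtain ⟨g₀, hg₀, g, hg⟩ := Metric.dense_iff.1
    (Lp.boundedContinuousFunction_dense 𝕜 (volume.restrict (Ioo a b)) hp) f (ε / 2) (half_pos hε)
  set V : ℝ := (measureUnivNNReal (volume.restrict (Ioo a b)) : ℝ) ^ p.toReal⁻¹
  have hV : 0 ≤ V := by positivity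
  obtain ⟨c, D, hc, hcg⟩ := exists_egf_near a b g.continuous
    (show 0 < ε / (2 * (V + 1)) by positivity)
  have hm := memLp_egf hab (.of_eventually_zero hc) p
  refine ⟨hm.toLp _, ?_, c, D, hc, hm.coeFn_toLp⟩
  have h1 : ∀ᵐ x ∂(volume.restrict (Ioo a b)), ‖(g₀ - hm.toLp _ : LpInterval 𝕜 p a b) x‖ ≤
      ε / (2 * (V + 1)) := by
    have hg' : g₀ =ᵐ[volume.restrict (Ioo a b)] g := by
      have h : g.toContinuousMap.toAEEqFun (volume.restrict (Ioo a b)) = (g₀ : ℝ →ₘ[_] 𝕜) := hg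
      rw [← h]
      exact ContinuousMap.coeFn_toAEEqFun _ _
    filter_upwards [hg', hm.coeFn_toLp, Lp.coeFn_sub g₀ (hm.toLp _),
      ae_restrict_mem measurableSet_Ioo] with x hx1 hx2 hx3 hx4
    rw [hx3, Pi.sub_apply, hx1, hx2]
    exact hcg x (Ioo_subset_Icc_self hx4)
  have h2 : dist g₀ (hm.toLp _) < ε / 2 := by
    rw [dist_eq_norm]
    refine (Lp.norm_le_of_ae_bound (by positivity) h1).trans_lt ?_
    change V * _ < _
    rw [← mul_div_assoc, div_lt_div_iff₀ (by positivity) two_pos]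
    nlinarith
  rw [Metric.mem_ball] at hg₀ ⊢
  rw [dist_comm] at h2
  linarith [dist_triangle (hm.toLp _) g₀ f]

/-! ### Chaos -/

theorem dense_periodicPoints_derivOp (hab : a < b) (hp : p ≠ ∞) (hn : 1 ≤ n) :
    Dense (periodicPoints (derivOp 𝕜 p hab n)) := by
  refine Metric.dense_iff.2 fun f ε hε => ?_
  obtain ⟨g, hgf, c, D, hc, hg⟩ := Metric.dense_iff.1 (dense_polynomial (𝕜 := 𝕜) hab hp) f
    (ε / 2) (half_pos hε)
  obtain ⟨B, hB, hcB⟩ := exists_norm_le_of_eventually_zero hc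
  obtain ⟨N₀, hN₀⟩ := exists_forall_dist_lt (𝕜 := 𝕜) hab p hB (half_pos hε)
  set N := max (max N₀ D) 1
  have hN : 1 ≤ N := le_max_right _ _
  have hnN : N ≤ n * N := Nat.le_mul_of_pos_left _ hn
  have hN₀N : N₀ ≤ n * N := ((le_max_left _ _).trans (le_max_left _ _)).trans hnN
  have hDN : D ≤ n * N := ((le_max_right _ _).trans (le_max_left _ _)).trans hnN
  -- the coefficients of the polynomial, repeated with period `n * N`
  let d : ℕ → 𝕜 := fun i => c (i % (n * N))
  have hd : GeomBounded d := .of_norm_le fun i => hcB _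
  have hm := memLp_egf hab hd p
  refine ⟨hm.toLp _, ?_, N, hN, ?_⟩
  · have h1 : dist (hm.toLp _) g < ε / 2 := by
      refine hN₀ (n * N) hN₀N hd (.of_eventually_zero hc) hm.coeFn_toLp hg (fun i hi => ?_)
        fun i hi => ?_
      · simp only [d, Nat.mod_eq_of_lt hi]
      · rw [hc i (hDN.trans hi), sub_zero]
        exact (hcB _).trans (le_mul_of_one_le_right hB (one_le_pow₀ one_le_two))
    rw [Metric.mem_ball] at hgf ⊢
    linarith [dist_triangle (hm.toLp _) g f]
  · obtain ⟨h, hk⟩ := opPow_derivOp_egf hab hd hm.coeFn_toLp n N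
    refine ⟨h, Lp.ext (hk.trans ?_)⟩
    have : (fun i => d (n * N + i)) = d := by
      funext i
      simp only [d, Nat.add_mod_left]
    rw [this]
    exact hm.coeFn_toLp.symm

theorem isHypercyclic_derivOp (hab : a < b) (hp : p ≠ ∞) (hn : 1 ≤ n) :
    IsHypercyclic (derivOp 𝕜 p hab n) := by
  have : Fact (p ≠ ∞) := ⟨hp⟩
  obtain ⟨t, htP, htc, htd⟩ := (dense_polynomial (𝕜 := 𝕜) hab hp).exists_countable_dense_subset
  obtain ⟨u, rfl⟩ := htc.exists_eq_range htd.nonempty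
  choose q₀ D hD hq₀ using fun j => htP (mem_range_self j)
  -- unpairing lists every polynomial infinitely often
  obtain ⟨c, C, m, d, hC, hcC, hmd, hkd, hcq, hqd⟩ := exists_universal_sequence hn
    (fun k => q₀ (Nat.unpair k).1) fun k => ⟨_, hD (Nat.unpair k).1⟩
  have hc : GeomBounded c := ⟨C, fun j => (hcC j).trans (mul_le_mul_of_nonneg_left
    (by exact_mod_cast Nat.lt_two_pow_self) hC)⟩
  have hm := memLp_egf hab hc p
  have hpow := opPow_derivOp_egf hab hc hm.coeFn_toLp n
  have hdense : Dense (range fun k => opPow (derivOp 𝕜 p hab n) k ⟨hm.toLp _, (hpow k).1⟩) := by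
    refine Metric.dense_iff.2 fun f ε hε => ?_
    obtain ⟨_, hjf, j, rfl⟩ := Metric.dense_iff.1 htd f (ε / 2) (half_pos hε)
    obtain ⟨N₀, hN₀⟩ := exists_forall_dist_lt (𝕜 := 𝕜) hab p (mul_nonneg zero_le_two hC)
      (half_pos hε)
    have hj : (Nat.unpair (Nat.pair j N₀)).1 = j := by simp
    set k := Nat.pair j N₀
    refine ⟨_, ?_, m k, rfl⟩
    have hk : N₀ ≤ d k := (Nat.right_le_pair j N₀).trans (hkd k)
    have h1 : dist (opPow (derivOp 𝕜 p hab n) (m k) ⟨hm.toLp _, (hpow (m k)).1⟩) (u j) < ε / 2 := by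
      refine hN₀ (d k) hk (hc.shift _) (.of_eventually_zero (hD j)) (hpow (m k)).2 (hq₀ j)
        (fun i hi => ?_) fun i hi => ?_
      · rw [hcq k i hi, hj]
      · have h0 := hqd k i hi
        rw [hj] at h0
        rw [h0, sub_zero]
        refine (hcC _).trans ?_
        have h2 : n * m k + i + 1 ≤ 2 * 2 ^ i := by
          have := hmd k
          have : i < 2 ^ i := Nat.lt_two_pow_self
          omega
        have h3 : ((n * m k + i : ℕ) : ℝ) + 1 ≤ 2 * 2 ^ i := by exact_mod_cast h2
        calc C * (((n * m k + i : ℕ) : ℝ) + 1) ≤ C * (2 * 2 ^ i) :=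
              mul_le_mul_of_nonneg_left h3 hC
          _ = 2 * C * 2 ^ i := by ring
    rw [Metric.mem_ball] at hjf ⊢
    exact (dist_triangle _ (u j) f).trans_lt (by linarith)
  refine ⟨hm.toLp _, fun h0 => ?_, fun k => (hpow k).1, hdense⟩
  -- the orbit of `0` is `{0}`, which is not dense as `L_p(a,b)` contains the constant `1`
  have hsub : (range fun k => opPow (derivOp 𝕜 p hab n) k ⟨hm.toLp _, (hpow k).1⟩) ⊆
      {(0 : LpInterval 𝕜 p a b)} := by
    rintro _ ⟨k, rfl⟩
    have : (⟨hm.toLp _, (hpow k).1⟩ : (opPow (derivOp 𝕜 p hab n) k).domain) = 0 := Subtype.ext h0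
    simp only [this, LinearPMap.map_zero, mem_singleton_iff]
  have h1 : (memLp_const (1 : 𝕜)).toLp _ = (0 : LpInterval 𝕜 p a b) := by
    have := (hdense.mono hsub) ((memLp_const (1 : 𝕜)).toLp _)
    rwa [closure_singleton] at this
  have h2 := (Lp.eq_zero_iff_ae_eq_zero.1 h1).symm.trans (memLp_const (1 : 𝕜)).coeFn_toLp
  have hne : (ae (volume.restrict (Ioo a b))).NeBot := by
    rw [ae_neBot, Ne, Measure.restrict_eq_zero, Real.volume_Ioo]
    simpa using hab
  obtain ⟨x, hx⟩ := h2.exists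
  exact zero_ne_one hx

end Operator

end LinearChaos

theorem theorem3p4 (𝕜 : Type*) [RCLike 𝕜] (a b : ℝ) (hab : a < b) (p : ℝ≥0∞) [Fact (1 ≤ p)]
    (hp : p ≠ ∞) (n : ℕ) (hn : 1 ≤ n) :
    LinearChaos.IsChaotic (LinearChaos.derivOp 𝕜 p hab n) :=
  ⟨LinearChaos.isHypercyclic_derivOp hab hp hn, LinearChaos.dense_periodicPoints_derivOp hab hp hn⟩
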